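/- Let $G=(V,E,\mu,w)$ be a connected, locally finite weighted graph: $\mu:V\to(0,\infty)$ is a vertex measure, $w(x,y)=w(y,x)\ge 0$ is an edge weight, and two distinct vertices $x,y$ are joined by an edge if and only if $w(x,y)>0$. Let $p(t,x,y)$ be the (minimal) heat kernel of $G$ with respect to $\mu$, associated with the Laplacian $\Delta u(x)=\frac1{\mu(x)}\sum_{y}w(x,y)(u(y)-u(x))$; that is, the increasing limit, over finite sets $K\subset V$, of the Dirichlet heat kernels $p_K(t,x,y)=(e^{t\Delta_K})_{xy}/\mu(y)$, where $\Delta_K$ is the Laplacian on $K$ with zero boundary values outside $K$. Assume that $G$ is stochastically complete, i.e. $\sum_{y\in V}p(t,x,y)\mu(y)=1$ for all $t>0$ and $x\in V$, and that $\inf_{x\in V}\mu(x)>0$. Let $s\in(0,1)$ and $p\in[2,\infty)$. For $x\ne y$ put $$W_s(x,y)=\frac{s}{\Gamma(1-s)}\,\mu(x)\mu(y)\int_0^{\infty}p(t,x,y)\,t^{-1-s}\,dt,$$ and for a bounded function $u:V\to\mathbb R$ let $\nabla^s u(x)$ be the vector with components $\sqrt{W_s(x,y)/(2\mu(x))}\,(u(x)-u(y))$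 for $y\ne x$ and $0$ for $y=x$, indexed by $y\in V$, so that its length is $$|\nabla^s u|(x)=\Bigl(\frac1{2\mu(x)}\sum_{y\ne x}W_s(x,y)(u(x)-u(y))^2\Bigr)^{1/2}.$$ Let $L^q(V)$ be the usual space with respect to the measure $\mu$ (for $q=\infty$: the bounded functions with the supremum norm), and let $$W^{s,p}(V)=\Bigl\{u\in L^\infty(V):\int_V\bigl(|\nabla^s u|^p+|u|^p\bigr)\,d\mu<\infty\Bigr\},\qquad \|u\|_{W^{s,p}(V)}=\Bigl(\int_V\bigl(|\nabla^s u|^p+|u|^p\bigr)\,d\mu\Bigr)^{1/p}.$$ Then: (i) every function on $V$ with finite support belongs to $W^{s,p}(V)$; (ii) $W^{s,p}(V)$ with this norm is a reflexive Banach space; (iii) for every $q\in[p,\infty]$, $W^{s,p}(V)\subseteq L^q(V)$ and there is a constant $C$ such that $\|u\|_{L^q(V)}\le C\|u\|_{W^{s,p}(V)}$ for all $u\in W^{s,p}(V)$; (iv) if $u\in W^{s,p}(V)$, then $u^+=\max\{u,0\}$, $u^-=\min\{u,0\}$ and $|u|=u^+-u^-$ belong to $W^{s,p}(V)$. -/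

import Mathlib

open scoped ENNReal NNReal

/-- A weighted graph `G = (V, E, μ, w)`: a positive vertex measure `μ` and a symmetric edge weight
`w ≥ 0`.  The edge set `E` is the set of pairs of distinct vertices with positive weight. -/
structure WeightedGraph (V : Type*) where
  μ : V → ℝ
  w : V → V → ℝ
  μ_pos : ∀ x, 0 < μ x
  w_nonneg : ∀ x y, 0 ≤ w x y
  w_symm : ∀ x y, w x y = w y x

/-- A real normed space is reflexive if the canonical map into its bidual is onto. -/
def IsReflexiveSpace (F : Type*) [NormedAddCommGroup F] [NormedSpace ℝ F] : Prop :=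
  Function.Surjective (NormedSpace.inclusionInDoubleDual ℝ F)

namespace WeightedGraph

variable {V : Type*}

/-- The underlying simple graph `(V, E)`. -/
def graph (G : WeightedGraph V) : SimpleGraph V where
  Adj x y := x ≠ y ∧ 0 < G.w x y
  symm := ⟨fun x y h => ⟨h.1.symm, by rw [G.w_symm]; exact h.2⟩⟩
  loopless := ⟨fun _ h => h.1 rfl⟩

/-- Every vertex has finitely many neighbours. -/
def IsLocallyFinite (G : WeightedGraph V) : Prop :=
  ∀ x, {y | G.graph.Adj x y}.Finite

/-- The graph Laplacian `Δ u (x) = (1 / μ(x)) ∑_y w(x, y) (u(y) - u(x))`.  On a locally finite graph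
the sum is finite. -/
noncomputable def laplacian (G : WeightedGraph V) (u : V → ℝ) (x : V) : ℝ :=
  1 / G.μ x * ∑' y, G.w x y * (u y - u x)

open Classical in
/-- The Dirichlet Laplacian of a finite set `K` of vertices, as a matrix: `f : K → ℝ` is extended by
zero to `V`, the Laplacian is applied, and the result is restricted to `K`. -/
noncomputable def dirichletLaplacian (G : WeightedGraph V) (K : Finset V) : Matrix K K ℝ :=
  Matrix.of fun x y => G.laplacian (Pi.single (y : V) 1) x

open Classical in
/-- The Dirichlet heat kernel of a finite set `K`: the kernel with respect to `μ` of the semigroup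
`exp (t Δ_K)`, extended by zero outside `K × K`. -/
noncomputable def dirichletHeatKernel (G : WeightedGraph V) (K : Finset V) (t : ℝ) (x y : V) : ℝ :=
  if h : x ∈ K ∧ y ∈ K then
    NormedSpace.exp (t • G.dirichletLaplacian K) ⟨x, h.1⟩ ⟨y, h.2⟩ / G.μ y
  else 0

/-- The (minimal) heat kernel `p(t, x, y)`, `t ≥ 0`, of `G`.  The Dirichlet heat kernels increase with
`K` and are bounded, so that this supremum is their limit along every exhaustion of `V` by finite
sets. -/
noncomputable def heatKernel (G : WeightedGraph V) (t : ℝ) (x y : V) : ℝ :=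
  ⨆ K : Finset V, G.dirichletHeatKernel K t x y

/-- `∑_y p(t, x, y) μ(y) = 1` for all `t > 0` and all `x`. -/
def IsStochasticallyComplete (G : WeightedGraph V) : Prop :=
  ∀ t : ℝ, 0 < t → ∀ x, HasSum (fun y => G.heatKernel t x y * G.μ y) 1

open Classical in
/-- The kernel `W_s(x, y)` for `x ≠ y`, with the value `0` on the diagonal. -/
noncomputable def fracKernel (G : WeightedGraph V) (s : ℝ) (x y : V) : ℝ :=
  if x = y then 0 else
    s / Real.Gamma (1 - s) * G.μ x * G.μ y *
      ∫ t in Set.Ioi (0 : ℝ), G.heatKernel t x y * t ^ (-1 - s)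

/-- The fractional gradient `∇^s u (x)`, a vector whose components are indexed by the vertices. -/
noncomputable def fracGradient (G : WeightedGraph V) (s : ℝ) (u : V → ℝ) (x : V) : V → ℝ :=
  fun y => Real.sqrt (G.fracKernel s x y / (2 * G.μ x)) * (u x - u y)

/-- The length `|∇^s u|(x)` of the fractional gradient, in `[0, ∞]`. -/
noncomputable def fracGradientLength (G : WeightedGraph V) (s : ℝ) (u : V → ℝ) (x : V) : ℝ≥0∞ :=
  (∑' y, ‖G.fracGradient s u x y‖ₑ ^ (2 : ℝ)) ^ (1 / 2 : ℝ)

lemma fracGradientLength_smul (G : WeightedGraph V) (s c : ℝ) (u : V → ℝ) (x : V) :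
    G.fracGradientLength s (c • u) x = ‖c‖ₑ * G.fracGradientLength s u x := by
  have h : ∀ y, ‖G.fracGradient s (c • u) x y‖ₑ ^ (2 : ℝ)
      = ‖c‖ₑ ^ (2 : ℝ) * ‖G.fracGradient s u x y‖ₑ ^ (2 : ℝ) := fun y => by
    rw [← ENNReal.mul_rpow_of_nonneg _ _ (by norm_num), ← enorm_mul]
    congr 2
    simp only [fracGradient, Pi.smul_apply, smul_eq_mul]
    ring
  simp only [fracGradientLength, h]
  rw [ENNReal.tsum_mul_left, ENNReal.mul_rpow_of_nonneg _ _ (by norm_num), ← ENNReal.rpow_mul]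
  norm_num

variable [MeasurableSpace V]

/-- The measure `∑_x μ(x) δ_x` on `V`; the space `L^q(V)` is `L^q` of this measure. -/
noncomputable def measure (G : WeightedGraph V) : MeasureTheory.Measure V :=
  MeasureTheory.Measure.sum fun x => ENNReal.ofReal (G.μ x) • MeasureTheory.Measure.dirac x

/-- `(∫_V (|∇^s u|^p + |u|^p) dμ)^{1/p}`, in `[0, ∞]`. -/
noncomputable def sobolevENorm (G : WeightedGraph V) (s p : ℝ) (u : V → ℝ) : ℝ≥0∞ :=
  (∫⁻ x, (G.fracGradientLength s u x ^ p + ‖u x‖ₑ ^ p) ∂G.measure) ^ (1 / p)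

lemma fracGradientLength_add_le [DiscreteMeasurableSpace V] (G : WeightedGraph V) (s : ℝ)
    (u v : V → ℝ) (x : V) :
    G.fracGradientLength s (u + v) x ≤ G.fracGradientLength s u x + G.fracGradientLength s v x := by
  have key := ENNReal.lintegral_Lp_add_le (μ := MeasureTheory.Measure.count) (p := 2)
    (f := fun y => ‖G.fracGradient s u x y‖ₑ) (g := fun y => ‖G.fracGradient s v x y‖ₑ)
    (Measurable.of_discrete.aemeasurable) (Measurable.of_discrete.aemeasurable) (by norm_num)
  simp only [MeasureTheory.lintegral_count, Pi.add_apply] at key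
  refine le_trans ?_ key
  unfold fracGradientLength
  gcongr with y
  refine le_trans (le_of_eq ?_) (enorm_add_le _ _)
  congr 1
  simp only [fracGradient, Pi.add_apply]
  ring

lemma sobolevENorm_add_le [DiscreteMeasurableSpace V] (G : WeightedGraph V) (s : ℝ) {p : ℝ}
    (hp : 1 ≤ p) (u v : V → ℝ) :
    G.sobolevENorm s p (u + v) ≤ G.sobolevENorm s p u + G.sobolevENorm s p v := by
  have hp0 : 0 < p := by linarith
  have e : ∀ a : ℝ≥0∞, (a ^ (1 / p)) ^ p = a := fun a => by
    rw [← ENNReal.rpow_mul, one_div, inv_mul_cancel₀ hp0.ne', ENNReal.rpow_one]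
  have key := ENNReal.lintegral_Lp_add_le (μ := G.measure) (p := p)
    (f := fun x => (G.fracGradientLength s u x ^ p + ‖u x‖ₑ ^ p) ^ (1 / p))
    (g := fun x => (G.fracGradientLength s v x ^ p + ‖v x‖ₑ ^ p) ^ (1 / p))
    (Measurable.of_discrete.aemeasurable) (Measurable.of_discrete.aemeasurable) hp
  simp only [e, Pi.add_apply] at key
  refine le_trans ?_ key
  unfold sobolevENorm
  gcongr with x
  have two := ENNReal.Lp_add_le (Finset.univ : Finset (Fin 2))
    ![G.fracGradientLength s u x, ‖u x‖ₑ] ![G.fracGradientLength s v x, ‖v x‖ₑ] hp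
  simp only [Fin.sum_univ_two, Matrix.cons_val_zero, Matrix.cons_val_one, Matrix.cons_val_fin_one]
    at two
  refine le_trans ?_ (ENNReal.rpow_le_rpow two hp0.le)
  rw [e]
  gcongr
  · exact fracGradientLength_add_le G s u v x
  · exact enorm_add_le _ _

lemma sobolevENorm_smul [DiscreteMeasurableSpace V] (G : WeightedGraph V) (s : ℝ) {p : ℝ}
    (hp : 1 ≤ p) (c : ℝ) (u : V → ℝ) :
    G.sobolevENorm s p (c • u) = ‖c‖ₑ * G.sobolevENorm s p u := by
  have hp0 : 0 < p := by linarith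
  have h : ∀ x, G.fracGradientLength s (c • u) x ^ p + ‖(c • u) x‖ₑ ^ p
      = ‖c‖ₑ ^ p * (G.fracGradientLength s u x ^ p + ‖u x‖ₑ ^ p) := fun x => by
    rw [fracGradientLength_smul, Pi.smul_apply, smul_eq_mul, enorm_mul,
      ENNReal.mul_rpow_of_nonneg _ _ hp0.le, ENNReal.mul_rpow_of_nonneg _ _ hp0.le, mul_add]
  simp only [sobolevENorm, h]
  rw [MeasureTheory.lintegral_const_mul _ Measurable.of_discrete,
    ENNReal.mul_rpow_of_nonneg _ _ (by positivity), ← ENNReal.rpow_mul, mul_one_div_cancel hp0.ne',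
    ENNReal.rpow_one]

lemma sobolevENorm_eq_zero [DiscreteMeasurableSpace V] (G : WeightedGraph V) (s : ℝ) {p : ℝ}
    (hp : 1 ≤ p) {u : V → ℝ} (h : G.sobolevENorm s p u = 0) : u = 0 := by
  have hp0 : 0 < p := by linarith
  rw [sobolevENorm, ENNReal.rpow_eq_zero_iff_of_pos (by positivity), measure,
    MeasureTheory.lintegral_sum_measure, ENNReal.tsum_eq_zero] at h
  funext x
  have hx := h x
  rw [MeasureTheory.lintegral_smul_measure, MeasureTheory.lintegral_dirac, smul_eq_mul,
    mul_eq_zero, add_eq_zero] at hx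
  rcases hx with hx | hx
  · exact absurd (ENNReal.ofReal_eq_zero.1 hx) (not_le.2 (G.μ_pos x))
  · simpa [hp0, hp0.le, hp0.not_gt] using hx.2

lemma sobolevENorm_zero (G : WeightedGraph V) (s : ℝ) {p : ℝ} (hp : 1 ≤ p) :
    G.sobolevENorm s p 0 = 0 := by
  have hp0 : 0 < p := by linarith
  simp [sobolevENorm, fracGradientLength, fracGradient, hp0]

/-- The fractional Sobolev space `W^{s,p}(V)`, `p ∈ [2, ∞)`, as a linear subspace of the space of all
functions on `V`: the `u ∈ L^∞(V)` with `∫_V (|∇^s u|^p + |u|^p) dμ < ∞`. -/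
def sobolevSubmodule [DiscreteMeasurableSpace V] (G : WeightedGraph V) (s p : ℝ)
    [hp : Fact (2 ≤ p)] : Submodule ℝ (V → ℝ) where
  carrier := {u | MeasureTheory.MemLp u ∞ G.measure ∧
    ∫⁻ x, (G.fracGradientLength s u x ^ p + ‖u x‖ₑ ^ p) ∂G.measure < ∞}
  add_mem' := by
    have hp1 : 1 ≤ p := by linarith [hp.out]
    have hp0 : 0 < 1 / p := by positivity
    rintro u v ⟨hu, hu'⟩ ⟨hv, hv'⟩
    refine ⟨hu.add hv, ?_⟩
    rw [← ENNReal.rpow_lt_top_iff_of_pos hp0] at hu' hv' ⊢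
    exact (sobolevENorm_add_le G s hp1 u v).trans_lt (ENNReal.add_lt_top.2 ⟨hu', hv'⟩)
  zero_mem' := by
    have hp1 : 1 ≤ p := by linarith [hp.out]
    have hp0 : 0 < 1 / p := by positivity
    refine ⟨MeasureTheory.MemLp.zero, ?_⟩
    rw [← ENNReal.rpow_lt_top_iff_of_pos hp0]
    exact (sobolevENorm_zero G s hp1).trans_lt ENNReal.zero_lt_top
  smul_mem' := by
    have hp1 : 1 ≤ p := by linarith [hp.out]
    have hp0 : 0 < 1 / p := by positivity
    rintro c u ⟨hu, hu'⟩
    refine ⟨hu.const_smul c, ?_⟩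
    rw [← ENNReal.rpow_lt_top_iff_of_pos hp0] at hu' ⊢
    exact (sobolevENorm_smul G s hp1 c u).trans_lt (ENNReal.mul_lt_top enorm_lt_top hu')

/-- `W^{s,p}(V)` as a type of its own, so that it carries the Sobolev norm and its topology instead of
the topology of pointwise convergence. -/
def SobolevSpace [DiscreteMeasurableSpace V] (G : WeightedGraph V) (s p : ℝ) [Fact (2 ≤ p)] :
    Type _ :=
  ↥(G.sobolevSubmodule s p)

namespace SobolevSpace

variable [DiscreteMeasurableSpace V] (G : WeightedGraph V) (s p : ℝ) [hp : Fact (2 ≤ p)]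

instance : CoeFun (G.SobolevSpace s p) fun _ => V → ℝ := ⟨Subtype.val⟩

noncomputable instance : AddCommGroup (G.SobolevSpace s p) :=
  inferInstanceAs (AddCommGroup ↥(G.sobolevSubmodule s p))

noncomputable instance : Module ℝ (G.SobolevSpace s p) :=
  inferInstanceAs (Module ℝ ↥(G.sobolevSubmodule s p))

/-- The Sobolev norm `‖u‖ = (∫_V (|∇^s u|^p + |u|^p) dμ)^{1/p}`. -/
noncomputable instance : Norm (G.SobolevSpace s p) := ⟨fun u => (G.sobolevENorm s p u).toReal⟩

lemma sobolevENorm_ne_top (u : G.SobolevSpace s p) : G.sobolevENorm s p u ≠ ∞ := by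
  have hp0 : 0 < 1 / p := by have := hp.out; positivity
  exact ((ENNReal.rpow_lt_top_iff_of_pos hp0).2 u.2.2).ne

lemma core : NormedSpace.Core ℝ (G.SobolevSpace s p) where
  norm_nonneg _ := ENNReal.toReal_nonneg
  norm_smul c u := by
    have hp1 : 1 ≤ p := by linarith [hp.out]
    change (G.sobolevENorm s p (c • u.1)).toReal = ‖c‖ * (G.sobolevENorm s p u.1).toReal
    rw [sobolevENorm_smul G s hp1, ENNReal.toReal_mul, toReal_enorm]
  norm_triangle u v := by
    have hp1 : 1 ≤ p := by linarith [hp.out]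
    change (G.sobolevENorm s p (u.1 + v.1)).toReal ≤
      (G.sobolevENorm s p u.1).toReal + (G.sobolevENorm s p v.1).toReal
    have hu := sobolevENorm_ne_top G s p u
    have hv := sobolevENorm_ne_top G s p v
    rw [← ENNReal.toReal_add hu hv]
    exact ENNReal.toReal_mono (ENNReal.add_ne_top.2 ⟨hu, hv⟩) (sobolevENorm_add_le G s hp1 _ _)
  norm_eq_zero_iff u := by
    have hp1 : 1 ≤ p := by linarith [hp.out]
    constructor
    · intro h
      have h0 : G.sobolevENorm s p u.1 = 0 :=
        ((ENNReal.toReal_eq_zero_iff _).1 h).resolve_right (sobolevENorm_ne_top G s p u)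
      exact Subtype.ext (sobolevENorm_eq_zero G s hp1 h0)
    · rintro rfl
      change (G.sobolevENorm s p 0).toReal = 0
      rw [sobolevENorm_zero G s hp1, ENNReal.toReal_zero]

noncomputable instance : NormedAddCommGroup (G.SobolevSpace s p) :=
  NormedAddCommGroup.ofCore (core G s p)

noncomputable instance : NormedSpace ℝ (G.SobolevSpace s p) :=
  NormedSpace.ofCore (core G s p)

end SobolevSpace

end WeightedGraph

/-!
The four assertions rest on two facts.

*The fractional kernel is summable in each variable.* By stochastic completeness,
`∑_{y ≠ x} p(t, x, y) μ(y) = 1 - p(t, x, x) μ(x)`. The Dirichlet heat kernels of finite sets are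
sub-Markovian (`dirichletHeatKernel_le`), so that the heat kernel `p(t, x, y)` is a genuine supremum
and dominates the Dirichlet heat kernel of `{x}`, which is `e^{-t Deg(x)} / μ(x)`. Hence the sum is
at most `min 1 (t Deg(x))` (`sum_heatKernel_le`), which is integrable against `t^{-1-s} dt`; this is
`tsum_fracKernel_lt_top`. As `W_s` is symmetric, the exponent is at least `2` and `inf μ > 0`, it
follows that indicator functions of vertices have finite Sobolev norm, hence so do all functions of
finite support.

*The Sobolev norm is an `L^p` norm of Hilbert space valued functions, with exponent `p ≥ 2`.* The
parallelogram identity at each vertex, raised to the power `p / 2`, gives Clarkson's inequality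
(`SobolevSpace.norm_add_rpow_add_norm_sub_rpow_le`), and with it uniform convexity. The space is
complete because norm convergence implies pointwise convergence (`enorm_apply_le_sobolevENorm`,
which uses `inf μ > 0`) and the norm is lower semicontinuous for the latter
(`lowerSemicontinuous_sobolevENorm`). Reflexivity is then the Milman–Pettis theorem
(`isReflexiveSpace_of_uniformConvexSpace`), proved here from a finite-dimensional separation
argument.

The embeddings interpolate between the pointwise bound and the `L^p` part of the norm, and the last
assertion holds because `1`-Lipschitz functions fixing `0` do not increase either part of the norm.
-/

/-! ### The Milman–Pettis theorem -/

section MilmanPettis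

open Filter Topology

variable {E : Type*} [NormedAddCommGroup E] [NormedSpace ℝ E]

/-- A finite-dimensional form of Goldstine's theorem: on finitely many functionals, an element of
the bidual is approximated by vectors of at most the same norm. Otherwise a linear combination `F`
of these functionals would separate `ξ` from the ball of radius `‖ξ‖`, that is, `‖ξ‖ * ‖F‖ < ξ F`.
-/
lemma mem_closure_image_closedBall_of_bidual {ι : Type*} [Fintype ι]
    (ξ : StrongDual ℝ (StrongDual ℝ E)) (f : ι → StrongDual ℝ E) :
    (fun i => ξ (f i)) ∈ closure ((fun x i => f i x) '' Metric.closedBall (0 : E) ‖ξ‖) := by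
  classical
  by_contra hnot
  have hconv : Convex ℝ (closure ((fun x i => f i x) '' Metric.closedBall (0 : E) ‖ξ‖)) :=
    ((convex_closedBall (0 : E) ‖ξ‖).linear_image (LinearMap.pi fun i => (f i).toLinearMap)).closure
  obtain ⟨g, r, hr, hgr⟩ := geometric_hahn_banach_closed_point hconv isClosed_closure hnot
  have hg : ∀ v : ι → ℝ, g v = ∑ i, v i * g (Pi.single i 1) := fun v => by
    conv_lhs => rw [pi_eq_sum_univ' v]
    simp [map_sum, map_smul]
  set F : StrongDual ℝ E := ∑ i, g (Pi.single i 1) • f i with hF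
  have hFx : ∀ x, F x = g fun i => f i x := fun x => by
    rw [hg, hF]
    simp [mul_comm]
  have hFξ : ξ F = g fun i => ξ (f i) := by
    rw [hg, hF]
    simp [map_sum, mul_comm]
  have hball : ∀ x : E, ‖x‖ ≤ ‖ξ‖ → F x < r := fun x hx => by
    rw [hFx]
    exact hr _ (subset_closure ⟨x, by simpa using hx, rfl⟩)
  have hn : ‖‖ξ‖‖ = ‖ξ‖ := Real.norm_of_nonneg ξ.opNorm_nonneg
  have hr0 : 0 < r := by simpa using hball 0 (norm_zero.trans_le ξ.opNorm_nonneg)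
  have hFn : ‖‖ξ‖ • F‖ ≤ r := by
    refine ContinuousLinearMap.opNorm_le_of_unit_norm hr0.le fun x hx => ?_
    have hx' : ‖‖ξ‖ • x‖ ≤ ‖ξ‖ := by rw [norm_smul, hn, hx, mul_one]
    have h1 := hball _ hx'
    have h2 := hball (-(‖ξ‖ • x)) (by rwa [norm_neg])
    rw [map_neg, map_smul] at h2
    rw [map_smul] at h1
    rw [smul_apply, Real.norm_eq_abs, abs_le]
    exact ⟨by linarith, h1.le⟩
  rw [norm_smul, hn] at hFn
  have h1 : ξ F ≤ ‖ξ‖ * ‖F‖ := (le_abs_self _).trans (ξ.le_opNorm F)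
  linarith [hFξ ▸ hgr]

/-- The Milman–Pettis theorem. The approximations of an element `ξ` of the bidual by vectors of norm
at most `‖ξ‖` form a filter; uniform convexity makes it a Cauchy filter, since some functional in
the unit ball is almost equal to `‖ξ‖` along it, and its limit represents `ξ`. -/
theorem isReflexiveSpace_of_uniformConvexSpace [UniformConvexSpace E] [CompleteSpace E] :
    IsReflexiveSpace E := by
  classical
  intro ξ
  let ev : E → StrongDual ℝ E → ℝ := fun x f => f x
  let 𝓕 : Filter E := comap ev (𝓝 fun f => ξ f) ⊓ 𝓟 (Metric.closedBall 0 ‖ξ‖)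
  have hmem : ∀ f : StrongDual ℝ E, Tendsto (fun x => f x) 𝓕 (𝓝 (ξ f)) := fun f =>
    (((continuous_apply f).tendsto fun f => ξ f).comp (tendsto_comap (f := ev))).mono_left
      inf_le_left
  have hball : Metric.closedBall (0 : E) ‖ξ‖ ∈ 𝓕 := mem_inf_of_right (mem_principal_self _)
  have hne : 𝓕.NeBot := by
    refine ((nhds_basis_opens _).comap ev |>.inf_principal _).neBot_iff.2 ?_
    rintro U ⟨hξU, hU⟩
    obtain ⟨I, u, hu, hIu⟩ := isOpen_pi_iff.1 hU _ hξU
    have hcl := mem_closure_image_closedBall_of_bidual ξ (fun i : I => (i : StrongDual ℝ E))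
    obtain ⟨_, hv, x, hx, rfl⟩ := mem_closure_iff.1 hcl (Set.univ.pi fun i : I => u i)
      (isOpen_set_pi Set.finite_univ fun i _ => (hu i i.2).1) (fun i _ => (hu i i.2).2)
    exact ⟨x, hIu fun f hf => hv ⟨f, hf⟩ trivial, hx⟩
  have hcauchy : Cauchy 𝓕 := by
    refine Metric.cauchy_iff.2 ⟨hne, fun ε hε => ?_⟩
    obtain ⟨δ, hδ, H⟩ := exists_forall_closed_ball_dist_add_le_two_mul_sub E hε ‖ξ‖
    obtain ⟨f, hf1, hf⟩ : ∃ f : StrongDual ℝ E, ‖f‖ ≤ 1 ∧ ‖ξ‖ - δ / 2 < ξ f := by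
      obtain ⟨f, hf1, hf⟩ := ξ.exists_lt_apply_of_lt_opNorm
        (show ‖ξ‖ - δ / 2 < ‖ξ‖ by linarith)
      rcases le_total 0 (ξ f) with h | h
      · exact ⟨f, hf1.le, by rwa [Real.norm_of_nonneg h] at hf⟩
      · exact ⟨-f, by simpa using hf1.le, by rwa [Real.norm_of_nonpos h, ← map_neg] at hf⟩
    refine ⟨_, inter_mem hball ((hmem f).eventually (lt_mem_nhds hf)), ?_⟩
    rintro x ⟨hx, hfx⟩ y ⟨hy, hfy⟩
    rw [mem_closedBall_zero_iff] at hx hy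
    by_contra! hxy
    rw [dist_eq_norm] at hxy
    have h1 := H hx hy hxy
    have h2 : f (x + y) ≤ ‖x + y‖ := (le_abs_self _).trans ((f.le_opNorm _).trans
      (mul_le_of_le_one_left (norm_nonneg _) hf1))
    rw [map_add] at h2
    have hfx' : ‖ξ‖ - δ / 2 < f x := hfx
    have hfy' : ‖ξ‖ - δ / 2 < f y := hfy
    linarith
  obtain ⟨x, hx⟩ := CompleteSpace.complete hcauchy
  refine ⟨x, ContinuousLinearMap.ext fun f => ?_⟩
  exact tendsto_nhds_unique ((f.continuous.tendsto x).mono_left hx) (hmem f)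

end MilmanPettis

/-! ### Clarkson's inequality -/

lemma enorm_rpow_two (r : ℝ) : ‖r‖ₑ ^ (2 : ℝ) = ENNReal.ofReal (r ^ 2) := by
  rw [Real.enorm_eq_ofReal_abs, ENNReal.ofReal_rpow_of_nonneg (abs_nonneg r) zero_le_two,
    Real.rpow_two, sq_abs]

lemma enorm_add_rpow_two_add_enorm_sub_rpow_two (a b : ℝ) :
    ‖a + b‖ₑ ^ (2 : ℝ) + ‖a - b‖ₑ ^ (2 : ℝ) = 2 * (‖a‖ₑ ^ (2 : ℝ) + ‖b‖ₑ ^ (2 : ℝ)) := by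
  have h2 : (2 : ℝ≥0∞) = ENNReal.ofReal 2 := by simp
  simp only [enorm_rpow_two]
  rw [← ENNReal.ofReal_add (sq_nonneg _) (sq_nonneg _),
    ← ENNReal.ofReal_add (sq_nonneg _) (sq_nonneg _), h2, ← ENNReal.ofReal_mul zero_le_two]
  congr 1
  ring

/-- Clarkson's inequality for exponents `p ≥ 2` in its pointwise form: if `c`, `d` are the lengths
of the sum and the difference of two vectors of a Hilbert space of lengths `a`, `b`, then
`c^p + d^p ≤ (c² + d²)^{p/2} = (2 (a² + b²))^{p/2} ≤ 2^{p-1} (a^p + b^p)` by convexity. -/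
lemma ENNReal.rpow_add_rpow_le_of_parallelogram {p : ℝ} (hp : 2 ≤ p) {a b c d : ℝ≥0∞}
    (h : c ^ (2 : ℝ) + d ^ (2 : ℝ) = 2 * (a ^ (2 : ℝ) + b ^ (2 : ℝ))) :
    c ^ p + d ^ p ≤ 2 ^ (p - 1) * (a ^ p + b ^ p) := by
  have hp1 : 1 ≤ p / 2 := by linarith
  have hpow : ∀ e : ℝ≥0∞, e ^ p = (e ^ (2 : ℝ)) ^ (p / 2) := fun e => by
    rw [← ENNReal.rpow_mul]
    congr 1
    ring
  simp only [hpow]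
  calc (c ^ (2 : ℝ)) ^ (p / 2) + (d ^ (2 : ℝ)) ^ (p / 2)
      ≤ (c ^ (2 : ℝ) + d ^ (2 : ℝ)) ^ (p / 2) := ENNReal.add_rpow_le_rpow_add _ _ hp1
    _ = 2 ^ (p / 2) * (a ^ (2 : ℝ) + b ^ (2 : ℝ)) ^ (p / 2) := by
        rw [h, ENNReal.mul_rpow_of_nonneg _ _ (by linarith)]
    _ ≤ 2 ^ (p / 2) * (2 ^ (p / 2 - 1) * ((a ^ (2 : ℝ)) ^ (p / 2) + (b ^ (2 : ℝ)) ^ (p / 2))) := by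
        gcongr
        exact ENNReal.rpow_add_le_mul_rpow_add_rpow _ _ hp1
    _ = _ := by
        rw [← mul_assoc, ← ENNReal.rpow_add_of_nonneg _ _ (by linarith) (by linarith)]
        congr 2
        ring

/-- Clarkson's inequality gives `‖x + y‖^p ≤ 2^p - ε^p` for unit vectors at distance at least `ε`.
-/
lemma uniformConvexSpace_of_clarkson {E : Type*} [SeminormedAddCommGroup E] {p : ℝ} (hp : 0 < p)
    (h : ∀ x y : E, ‖x + y‖ ^ p + ‖x - y‖ ^ p ≤ 2 ^ (p - 1) * (‖x‖ ^ p + ‖y‖ ^ p)) :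
    UniformConvexSpace E := by
  refine ⟨fun ε hε => ?_⟩
  by_cases hε2 : ε ≤ 2
  · have hnonneg : (0 : ℝ) ≤ 2 ^ p - ε ^ p :=
      sub_nonneg.2 (Real.rpow_le_rpow hε.le hε2 hp.le)
    refine ⟨2 - (2 ^ p - ε ^ p) ^ p⁻¹, ?_, fun x hx y hy hxy => ?_⟩
    · have h1 : (2 ^ p - ε ^ p) ^ p⁻¹ < ((2 : ℝ) ^ p) ^ p⁻¹ :=
        Real.rpow_lt_rpow hnonneg (by linarith [Real.rpow_pos_of_pos hε p]) (inv_pos.2 hp)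
      rw [Real.rpow_rpow_inv zero_le_two hp.ne'] at h1
      linarith
    · have h1 := h x y
      have h2 := Real.rpow_le_rpow hε.le hxy hp.le
      have h3 : (2 : ℝ) ^ (p - 1) * 2 = 2 ^ p := by
        rw [Real.rpow_sub_one two_ne_zero, div_mul_cancel₀ _ two_ne_zero]
      rw [hx, hy, Real.one_rpow, one_add_one_eq_two, h3] at h1
      rw [sub_sub_cancel, Real.le_rpow_inv_iff_of_pos (norm_nonneg _) hnonneg hp]
      linarith
  · -- the distance of two unit vectors is at most `2`
    refine ⟨1, one_pos, fun x hx y hy hxy => ?_⟩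
    have := norm_sub_le x y
    linarith

/-! ### Exponentials of sub-Markovian generators -/

section MatrixExp

attribute [local instance] Matrix.linftyOpNormedAddCommGroup Matrix.linftyOpNormedRing
  Matrix.linftyOpNormedAlgebra

lemma norm_exp_le_exp_norm_of_normOneClass {𝔸 : Type*} [NormedRing 𝔸] [NormedAlgebra ℝ 𝔸]
    [CompleteSpace 𝔸] [NormOneClass 𝔸] (a : 𝔸) : ‖NormedSpace.exp a‖ ≤ Real.exp ‖a‖ := by
  rw [NormedSpace.exp_eq_tsum ℝ, Real.exp_eq_exp_ℝ, NormedSpace.exp_eq_tsum ℝ]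
  refine tsum_of_norm_bounded (NormedSpace.expSeries_summable' (𝕂 := ℝ) ‖a‖).hasSum fun n => ?_
  rw [norm_smul, smul_eq_mul, Real.norm_of_nonneg (by positivity)]
  gcongr
  exact norm_pow_le a n

/-- The entries of `exp A` are at most `1` in absolute value if `A` has nonnegative entries off the
diagonal and nonpositive row sums: for large `c`, the matrix `A + c` has nonnegative entries and row
sums at most `c`, so that `‖exp A‖ = e^{-c} ‖exp (A + c)‖ ≤ 1` for the operator norm on `ℓ^∞`. -/
lemma abs_exp_apply_le_one_of_subMarkov {ι : Type*} [Fintype ι] [DecidableEq ι] (A : Matrix ι ι ℝ)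
    (hoff : ∀ i j, i ≠ j → 0 ≤ A i j) (hrow : ∀ i, ∑ j, A i j ≤ 0) (i j : ι) :
    |NormedSpace.exp A i j| ≤ 1 := by
  have : Nonempty ι := ⟨i⟩
  set c : ℝ := ∑ k, |A k k| with hc
  have hc0 : 0 ≤ c := Finset.sum_nonneg fun _ _ => abs_nonneg _
  set P : Matrix ι ι ℝ := A + c • 1 with hP
  have hPpos : ∀ k l, 0 ≤ P k l := fun k l => by
    rcases eq_or_ne k l with rfl | hkl
    · have h1 : |A k k| ≤ c :=
        Finset.single_le_sum (f := fun k => |A k k|) (fun _ _ => abs_nonneg _) (Finset.mem_univ k)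
      have h2 := neg_abs_le (A k k)
      simp only [hP, Matrix.add_apply, Matrix.smul_apply, Matrix.one_apply_eq, smul_eq_mul, mul_one]
      linarith
    · simpa [hP, Matrix.one_apply_ne hkl] using hoff k l hkl
  have hPn : ‖P‖ ≤ c := by
    have hle : ‖P‖₊ ≤ c.toNNReal := by
      rw [Matrix.linfty_opNNNorm_def]
      refine Finset.sup_le fun k _ => ?_
      rw [← NNReal.coe_le_coe, Real.coe_toNNReal c hc0, NNReal.coe_sum]
      simp only [coe_nnnorm, Real.norm_of_nonneg (hPpos k _)]
      have := hrow k
      simp only [hP, Matrix.add_apply, Matrix.smul_apply, Matrix.one_apply, smul_eq_mul, mul_ite,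
        mul_one, mul_zero, Finset.sum_add_distrib, Finset.sum_ite_eq, Finset.mem_univ, if_true]
      linarith
    have := NNReal.coe_le_coe.2 hle
    rwa [Real.coe_toNNReal c hc0, coe_nnnorm] at this
  have hA : A = P + (-c) • (1 : Matrix ι ι ℝ) := by rw [hP, neg_smul]; abel
  have hexp : NormedSpace.exp A = Real.exp (-c) • NormedSpace.exp P := by
    rw [hA, Matrix.exp_add_of_commute _ _ ((Commute.one_right P).smul_right _),
      Matrix.smul_one_eq_diagonal, Matrix.exp_diagonal]
    ext k l
    simp [Matrix.mul_diagonal, Real.exp_eq_exp_ℝ, mul_comm]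
  have hentry : |NormedSpace.exp A i j| ≤ ‖NormedSpace.exp A‖ := by
    rw [← Real.norm_eq_abs, ← coe_nnnorm, ← coe_nnnorm, NNReal.coe_le_coe,
      Matrix.linfty_opNNNorm_def]
    exact (Finset.single_le_sum (f := fun l => ‖NormedSpace.exp A i l‖₊) (fun _ _ => zero_le)
      (Finset.mem_univ j)).trans (Finset.le_sup (f := fun k => ∑ l, ‖NormedSpace.exp A k l‖₊)
      (Finset.mem_univ i))
  refine hentry.trans ?_
  rw [hexp, norm_smul, Real.norm_of_nonneg (Real.exp_pos _).le]
  calc Real.exp (-c) * ‖NormedSpace.exp P‖ ≤ Real.exp (-c) * Real.exp c := by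
        gcongr
        exact (norm_exp_le_exp_norm_of_normOneClass P).trans (Real.exp_le_exp.2 hPn)
    _ = 1 := by rw [← Real.exp_add]; simp

/-- If `A` is symmetric with respect to the weight `m`, so is `exp A`. -/
lemma mul_exp_apply_comm {ι : Type*} [Fintype ι] [DecidableEq ι] (A : Matrix ι ι ℝ) (m : ι → ℝ)
    (hm : ∀ i, m i ≠ 0) (h : ∀ i j, m i * A i j = m j * A j i) (i j : ι) :
    m i * NormedSpace.exp A i j = m j * NormedSpace.exp A j i := by
  have hU : IsUnit (Matrix.diagonal m) := by
    rw [Matrix.isUnit_diagonal, Pi.isUnit_iff]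
    exact fun i => (hm i).isUnit
  have hdet := (Matrix.isUnit_iff_isUnit_det _).1 hU
  have hcomm : Matrix.diagonal m * A = A.transpose * Matrix.diagonal m := by
    ext k l
    simp [Matrix.diagonal_mul, Matrix.mul_diagonal, h k l, mul_comm]
  have hconj : A.transpose = Matrix.diagonal m * A * (Matrix.diagonal m)⁻¹ := by
    rw [hcomm, Matrix.mul_nonsing_inv_cancel_right _ _ hdet]
  have hexp : (NormedSpace.exp A).transpose * Matrix.diagonal m
      = Matrix.diagonal m * NormedSpace.exp A := by
    rw [← Matrix.exp_transpose, hconj, Matrix.exp_conj _ _ hU,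
      Matrix.nonsing_inv_mul_cancel_right _ _ hdet]
  have := congr_fun (congr_fun hexp i) j
  simp only [Matrix.diagonal_mul, Matrix.mul_diagonal, Matrix.transpose_apply] at this
  rw [← this, mul_comm]

end MatrixExp

namespace WeightedGraph

/-! ### Bounds for the heat kernel -/

section HeatKernel

open Classical in
/-- The weighted degree `(1 / μ(x)) ∑_{y ≠ x} w(x, y)`. -/
noncomputable def weightedDegree {V : Type*} (G : WeightedGraph V) (x : V) : ℝ :=
  1 / G.μ x * ∑' y, if y = x then 0 else G.w x y

variable {V : Type*} {G : WeightedGraph V}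

open Classical in
lemma IsLocallyFinite.summable_weight (hlf : G.IsLocallyFinite) (x : V) :
    Summable fun y => if y = x then 0 else G.w x y := by
  refine summable_of_hasFiniteSupport ((hlf x).subset fun y hy => ?_)
  by_cases h : y = x
  · simp [h] at hy
  · simp only [Function.mem_support, h, if_false] at hy
    exact ⟨Ne.symm h, (G.w_nonneg x y).lt_of_ne' hy⟩

open Classical in
lemma laplacian_single_of_ne {x y : V} (h : x ≠ y) :
    G.laplacian (Pi.single y 1) x = G.w x y / G.μ x := by
  rw [laplacian, tsum_eq_single y]
  · simp [h]
    ring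
  · intro z hz
    simp [h, hz]

open Classical in
lemma laplacian_single_self (x : V) :
    G.laplacian (Pi.single x 1) x = -G.weightedDegree x := by
  rw [laplacian, weightedDegree, ← mul_neg, ← tsum_neg]
  congr 2 with y
  by_cases h : y = x <;> simp [h]

lemma mul_dirichletLaplacian_comm (K : Finset V) (x y : K) :
    G.μ x * G.dirichletLaplacian K x y = G.μ y * G.dirichletLaplacian K y x := by
  rcases eq_or_ne x y with rfl | h
  · rfl
  have h' : (x : V) ≠ y := fun e => h (Subtype.ext e)
  simp only [dirichletLaplacian, Matrix.of_apply, laplacian_single_of_ne h',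
    laplacian_single_of_ne h'.symm]
  rw [mul_div_cancel₀ _ (G.μ_pos x).ne', mul_div_cancel₀ _ (G.μ_pos y).ne', G.w_symm]

lemma dirichletLaplacian_nonneg_of_ne (K : Finset V) {x y : K} (h : x ≠ y) :
    0 ≤ G.dirichletLaplacian K x y := by
  rw [dirichletLaplacian, Matrix.of_apply, laplacian_single_of_ne fun e => h (Subtype.ext e)]
  exact div_nonneg (G.w_nonneg _ _) (G.μ_pos _).le

lemma sum_dirichletLaplacian_nonpos (hlf : G.IsLocallyFinite) (K : Finset V) (x : K) :
    ∑ y, G.dirichletLaplacian K x y ≤ 0 := by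
  classical
  have hentry : ∀ y : K, G.dirichletLaplacian K x y =
      (if (y : V) = x then -G.weightedDegree x else 0)
        + 1 / G.μ x * if (y : V) = x then 0 else G.w x y := fun y => by
    rw [dirichletLaplacian, Matrix.of_apply]
    by_cases h : (y : V) = x
    · rw [h, laplacian_single_self]
      simp
    · rw [laplacian_single_of_ne (Ne.symm h)]
      simp [h]
      ring
  have h1 : ∑ y : K, (if (y : V) = x then -G.weightedDegree x else 0) = -G.weightedDegree x := by
    rw [Finset.sum_eq_single x]
    · simp
    · intro y _ hy
      simp [Subtype.ext_iff.not.1 hy]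
    · simp
  simp only [hentry]
  rw [Finset.sum_add_distrib, h1, ← Finset.mul_sum,
    Finset.sum_coe_sort K fun y : V => if y = x then 0 else G.w x y, weightedDegree]
  have h2 := (hlf.summable_weight (x : V)).sum_le_tsum K fun y _ => by
    split_ifs
    exacts [le_rfl, G.w_nonneg x y]
  have h3 : 0 ≤ 1 / G.μ x := by have := G.μ_pos x; positivity
  linarith [mul_le_mul_of_nonneg_left h2 h3]

lemma dirichletHeatKernel_le (hlf : G.IsLocallyFinite) (K : Finset V) {t : ℝ} (ht : 0 ≤ t)
    (x y : V) : G.dirichletHeatKernel K t x y ≤ 1 / G.μ y := by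
  classical
  have hμ := G.μ_pos y
  rw [dirichletHeatKernel]
  split_ifs with h
  · gcongr
    refine (le_abs_self _).trans (abs_exp_apply_le_one_of_subMarkov _ (fun i j hij => ?_)
      (fun i => ?_) _ _)
    · exact mul_nonneg ht (dirichletLaplacian_nonneg_of_ne K hij)
    · simp only [Matrix.smul_apply, smul_eq_mul, ← Finset.mul_sum]
      exact mul_nonpos_of_nonneg_of_nonpos ht (sum_dirichletLaplacian_nonpos hlf K i)
  · positivity

lemma dirichletHeatKernel_comm (K : Finset V) (t : ℝ) (x y : V) :
    G.dirichletHeatKernel K t x y = G.dirichletHeatKernel K t y x := by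
  classical
  by_cases h : x ∈ K ∧ y ∈ K
  · rw [dirichletHeatKernel, dirichletHeatKernel, dif_pos h, dif_pos h.symm,
      div_eq_div_iff (G.μ_pos y).ne' (G.μ_pos x).ne', mul_comm, mul_comm _ (G.μ y)]
    refine mul_exp_apply_comm _ (fun z : K => G.μ z) (fun z => (G.μ_pos z).ne') (fun i j => ?_)
      ⟨x, h.1⟩ ⟨y, h.2⟩
    simp only [Matrix.smul_apply, smul_eq_mul]
    rw [mul_left_comm, mul_dirichletLaplacian_comm, mul_left_comm]
  · rw [dirichletHeatKernel, dirichletHeatKernel, dif_neg h, dif_neg fun h' => h h'.symm]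

lemma heatKernel_comm (t : ℝ) (x y : V) : G.heatKernel t x y = G.heatKernel t y x := by
  simp only [heatKernel, G.dirichletHeatKernel_comm]

/-- The supremum that defines the heat kernel is not a junk value. -/
lemma bddAbove_dirichletHeatKernel (hlf : G.IsLocallyFinite) {t : ℝ} (ht : 0 ≤ t) (x y : V) :
    BddAbove (Set.range fun K => G.dirichletHeatKernel K t x y) :=
  ⟨1 / G.μ y, by rintro _ ⟨K, rfl⟩; exact dirichletHeatKernel_le hlf K ht x y⟩

lemma heatKernel_nonneg (hlf : G.IsLocallyFinite) {t : ℝ} (ht : 0 ≤ t) (x y : V) :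
    0 ≤ G.heatKernel t x y :=
  le_ciSup_of_le (bddAbove_dirichletHeatKernel hlf ht x y) ∅ (by simp [dirichletHeatKernel])

/-- The probability of being at `x` at time `t` is at least that of not having left `x` by then,
which is the Dirichlet heat kernel of the single vertex `x`. -/
lemma exp_neg_le_heatKernel_self (hlf : G.IsLocallyFinite) {t : ℝ} (ht : 0 ≤ t) (x : V) :
    Real.exp (-(t * G.weightedDegree x)) ≤ G.heatKernel t x x * G.μ x := by
  rw [← div_le_iff₀ (G.μ_pos x)]
  refine le_ciSup_of_le (bddAbove_dirichletHeatKernel hlf ht x x) {x} (le_of_eq ?_)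
  classical
  rw [dirichletHeatKernel, dif_pos (by simp)]
  congr 1
  have hdiag : t • G.dirichletLaplacian {x}
      = Matrix.diagonal fun _ => -(t * G.weightedDegree x) := by
    ext ⟨i, hi⟩ ⟨j, hj⟩
    obtain rfl := Finset.mem_singleton.1 hi
    obtain rfl := Finset.mem_singleton.1 hj
    simp [dirichletLaplacian, laplacian_single_self]
  have key := Matrix.exp_diagonal
    (fun _ : ({x} : Finset V) => -(t * G.weightedDegree x))
  rw [hdiag]
  convert (congr_fun (congr_fun key _) _).symm using 1
  simp [Real.exp_eq_exp_ℝ]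

open Classical in
/-- By stochastic completeness, `∑_{y ≠ x} p(t, x, y) μ(y) = 1 - p(t, x, x) μ(x)`, and the
right-hand side is at most the probability `1 - e^{-t Deg(x)}` of having left `x` by the time `t`.
-/
lemma sum_heatKernel_le (hlf : G.IsLocallyFinite) (hsc : G.IsStochasticallyComplete) {t : ℝ}
    (ht : 0 < t) (x : V) (S : Finset V) :
    ∑ y ∈ S, (if x = y then 0 else G.heatKernel t x y * G.μ y)
      ≤ min 1 (t * G.weightedDegree x) := by
  have hpos : ∀ y, 0 ≤ G.heatKernel t x y * G.μ y := fun y =>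
    mul_nonneg (heatKernel_nonneg hlf ht.le x y) (G.μ_pos y).le
  have h1 : ∑ y ∈ insert x S, G.heatKernel t x y * G.μ y ≤ 1 :=
    sum_le_hasSum _ (fun y _ => hpos y) (hsc t ht x)
  have h2 : ∑ y ∈ S, (if x = y then 0 else G.heatKernel t x y * G.μ y)
      + G.heatKernel t x x * G.μ x ≤ 1 := by
    refine le_trans (le_of_eq ?_) h1
    rw [← Finset.sum_erase_add _ _ (Finset.mem_insert_self x S), Finset.erase_insert_eq_erase,
      Finset.sum_ite, Finset.sum_const_zero, zero_add]
    congr 2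
    ext y
    simp [eq_comm, and_comm]
  have h3 := exp_neg_le_heatKernel_self hlf ht.le x
  have h4 := Real.add_one_le_exp (-(t * G.weightedDegree x))
  exact le_min (by linarith [hpos x]) (by linarith)

end HeatKernel

/-! ### Summability of the fractional kernel -/

section FracKernel

variable {V : Type*} {G : WeightedGraph V} {s : ℝ}

lemma fracKernel_comm (x y : V) : G.fracKernel s x y = G.fracKernel s y x := by
  rcases eq_or_ne x y with rfl | h
  · rfl
  · simp only [fracKernel, h, h.symm, if_false, G.heatKernel_comm _ x y]
    ring

lemma fracKernel_nonneg (hlf : G.IsLocallyFinite) (hs : s ∈ Set.Ioo (0 : ℝ) 1) (x y : V) :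
    0 ≤ G.fracKernel s x y := by
  rw [fracKernel]
  split_ifs
  · exact le_rfl
  · have hΓ := Real.Gamma_pos_of_pos (sub_pos.2 hs.2)
    have hx := G.μ_pos x
    have hy := G.μ_pos y
    have h0 := hs.1
    refine mul_nonneg (by positivity) (MeasureTheory.setIntegral_nonneg measurableSet_Ioi ?_)
    intro t ht
    exact mul_nonneg (heatKernel_nonneg hlf (le_of_lt ht) x y) (Real.rpow_nonneg (le_of_lt ht) _)

lemma lintegral_min_one_mul_rpow_lt_top (hs : s ∈ Set.Ioo (0 : ℝ) 1) (D : ℝ) :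
    ∫⁻ t in Set.Ioi (0 : ℝ), ENNReal.ofReal (min 1 (t * D) * t ^ (-1 - s)) < ∞ := by
  rw [← Set.Ioc_union_Ioi_eq_Ioi zero_le_one]
  refine (MeasureTheory.lintegral_union_le _ _ _).trans_lt (ENNReal.add_lt_top.2 ⟨?_, ?_⟩)
  · have hint : MeasureTheory.IntegrableOn (fun t : ℝ => D * t ^ (-s)) (Set.Ioc 0 1) :=
      ((intervalIntegrable_iff_integrableOn_Ioc_of_le zero_le_one).1
        (intervalIntegral.intervalIntegrable_rpow' (by linarith [hs.2]))).const_mul D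
    refine (MeasureTheory.setLIntegral_mono' measurableSet_Ioc fun t ht => ?_).trans_lt
      hint.lintegral_lt_top
    refine ENNReal.ofReal_le_ofReal ?_
    have h1 : t ^ (-s) = t * t ^ (-1 - s) := by
      rw [show -s = 1 + (-1 - s) by ring, Real.rpow_add ht.1, Real.rpow_one]
    rw [h1, ← mul_assoc, mul_comm D]
    exact mul_le_mul_of_nonneg_right (min_le_right _ _) (Real.rpow_nonneg ht.1.le _)
  · have hint : MeasureTheory.IntegrableOn (fun t : ℝ => t ^ (-1 - s)) (Set.Ioi 1) :=
      integrableOn_Ioi_rpow_of_lt (by linarith [hs.1]) zero_lt_one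
    refine (MeasureTheory.setLIntegral_mono' measurableSet_Ioi fun t ht => ?_).trans_lt
      hint.lintegral_lt_top
    have ht0 : 0 < t := zero_lt_one.trans ht
    exact ENNReal.ofReal_le_ofReal
      (mul_le_of_le_one_left (Real.rpow_nonneg ht0.le _) (min_le_left _ _))

/-- Superadditivity of the lower integral; unlike additivity, it needs no measurability, here of the
heat kernel as a function of time. -/
lemma sum_lintegral_le_lintegral_sum {α ι : Type*} [MeasurableSpace α]
    (μ : MeasureTheory.Measure α) (S : Finset ι) (f : ι → α → ℝ≥0∞) :
    ∑ i ∈ S, ∫⁻ a, f i a ∂μ ≤ ∫⁻ a, ∑ i ∈ S, f i a ∂μ := by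
  classical
  induction S using Finset.induction_on with
  | empty => simp
  | insert i S hi ih =>
    simp only [Finset.sum_insert hi]
    exact (add_le_add_right ih _).trans (MeasureTheory.le_lintegral_add _ _)

/-- `∑_y W_s(x, y)` is finite: up to a constant, it is the integral of
`∑_{y ≠ x} p(t, x, y) μ(y) ≤ min 1 (t Deg(x))` against `t^{-1-s} dt`. -/
lemma tsum_fracKernel_lt_top (hlf : G.IsLocallyFinite) (hsc : G.IsStochasticallyComplete)
    (hs : s ∈ Set.Ioo (0 : ℝ) 1) (x : V) :
    ∑' y, ENNReal.ofReal (G.fracKernel s x y) < ∞ := by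
  classical
  set f : V → ℝ → ℝ := fun y t =>
    (if x = y then 0 else G.heatKernel t x y * G.μ y) * t ^ (-1 - s) with hf
  set c : ℝ := s / Real.Gamma (1 - s) * G.μ x with hc
  have hf0 : ∀ y, ∀ t ∈ Set.Ioi (0 : ℝ), 0 ≤ f y t := fun y t ht => by
    refine mul_nonneg ?_ (Real.rpow_nonneg (le_of_lt ht) _)
    split_ifs
    · exact le_rfl
    · exact mul_nonneg (heatKernel_nonneg hlf (le_of_lt ht) x y) (G.μ_pos y).le
  have hW : ∀ y, G.fracKernel s x y = c * ∫ t in Set.Ioi (0 : ℝ), f y t := fun y => by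
    by_cases h : x = y
    · simp [fracKernel, hf, h]
    · simp only [fracKernel, hf, h, if_false, hc]
      rw [mul_assoc _ (G.μ y), ← MeasureTheory.integral_const_mul]
      congr 3 with t
      ring
  have hWle : ∀ y, ENNReal.ofReal (G.fracKernel s x y)
      ≤ ‖c‖ₑ * ∫⁻ t in Set.Ioi (0 : ℝ), ENNReal.ofReal (f y t) := fun y => by
    refine (Real.ofReal_le_enorm _).trans ?_
    rw [hW, enorm_mul]
    gcongr
    refine (MeasureTheory.enorm_integral_le_lintegral_enorm _).trans (le_of_eq ?_)
    exact MeasureTheory.setLIntegral_congr_fun measurableSet_Ioi fun t ht =>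
      Real.enorm_of_nonneg (hf0 y t ht)
  have hbound : ∀ S : Finset V, ∑ y ∈ S, ENNReal.ofReal (G.fracKernel s x y) ≤ ‖c‖ₑ *
      ∫⁻ t in Set.Ioi (0 : ℝ), ENNReal.ofReal (min 1 (t * G.weightedDegree x) * t ^ (-1 - s)) := by
    intro S
    refine (Finset.sum_le_sum fun y _ => hWle y).trans ?_
    rw [← Finset.mul_sum]
    gcongr
    refine (sum_lintegral_le_lintegral_sum _ S _).trans
      (MeasureTheory.setLIntegral_mono' measurableSet_Ioi fun t ht => ?_)
    rw [← ENNReal.ofReal_sum_of_nonneg fun y _ => hf0 y t ht, hf, ← Finset.sum_mul]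
    exact ENNReal.ofReal_le_ofReal (mul_le_mul_of_nonneg_right (sum_heatKernel_le hlf hsc ht x S)
      (Real.rpow_nonneg (le_of_lt ht) _))
  rw [ENNReal.tsum_eq_iSup_sum]
  exact (iSup_le hbound).trans_lt (ENNReal.mul_lt_top enorm_lt_top
    (lintegral_min_one_mul_rpow_lt_top hs _))

end FracKernel

section Sobolev

variable {V : Type*} {G : WeightedGraph V} {s p : ℝ}

/-! ### The Sobolev norm as a sum over vertices -/

lemma iInf_μ_le (G : WeightedGraph V) (x : V) : ⨅ y, G.μ y ≤ G.μ x :=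
  ciInf_le ⟨0, by rintro _ ⟨y, rfl⟩; exact (G.μ_pos y).le⟩ x

lemma fracGradientLength_rpow_two (u : V → ℝ) (x : V) :
    G.fracGradientLength s u x ^ (2 : ℝ) = ∑' y, ‖G.fracGradient s u x y‖ₑ ^ (2 : ℝ) := by
  rw [fracGradientLength, ← ENNReal.rpow_mul]
  norm_num

lemma enorm_fracGradient_rpow_two (u : V → ℝ) {x y : V} (hW : 0 ≤ G.fracKernel s x y) :
    ‖G.fracGradient s u x y‖ₑ ^ (2 : ℝ)
      = ENNReal.ofReal (G.fracKernel s x y / (2 * G.μ x) * (u x - u y) ^ 2) := by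
  have := G.μ_pos x
  rw [enorm_rpow_two, fracGradient, mul_pow, Real.sq_sqrt (by positivity)]

variable [MeasurableSpace V]

lemma sobolevENorm_rpow (hp : 0 < p) (u : V → ℝ) : G.sobolevENorm s p u ^ p
    = ∫⁻ x, (G.fracGradientLength s u x ^ p + ‖u x‖ₑ ^ p) ∂G.measure := by
  rw [sobolevENorm, ← ENNReal.rpow_mul, one_div_mul_cancel hp.ne', ENNReal.rpow_one]

lemma lintegral_enorm_rpow_le_sobolevENorm_rpow (hp : 0 < p) (u : V → ℝ) :
    ∫⁻ x, ‖u x‖ₑ ^ p ∂G.measure ≤ G.sobolevENorm s p u ^ p := by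
  rw [sobolevENorm_rpow hp]
  exact MeasureTheory.lintegral_mono fun x => le_add_self

variable [DiscreteMeasurableSpace V]

lemma lintegral_measure (f : V → ℝ≥0∞) :
    ∫⁻ x, f x ∂G.measure = ∑' x, ENNReal.ofReal (G.μ x) * f x := by
  simp [measure, MeasureTheory.lintegral_sum_measure]

/-- The bound `|u(x)| ≤ (inf μ)^{-1/p} ‖u‖`, from the single term `μ(x) |u(x)|^p` of the norm. -/
lemma enorm_apply_le_sobolevENorm (hμ : 0 < ⨅ x, G.μ x) (hp : 0 < p) (u : V → ℝ) (x : V) :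
    ‖u x‖ₑ ≤ (ENNReal.ofReal (⨅ x, G.μ x))⁻¹ ^ (1 / p) * G.sobolevENorm s p u := by
  have hm0 : ENNReal.ofReal (⨅ x, G.μ x) ≠ 0 := (ENNReal.ofReal_pos.2 hμ).ne'
  have h1 : ENNReal.ofReal (⨅ x, G.μ x) * ‖u x‖ₑ ^ p ≤ G.sobolevENorm s p u ^ p := by
    refine le_trans ?_ (lintegral_enorm_rpow_le_sobolevENorm_rpow hp u)
    rw [lintegral_measure]
    refine le_trans ?_ (ENNReal.le_tsum x)
    gcongr
    exact G.iInf_μ_le x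
  rw [← ENNReal.rpow_le_rpow_iff hp, ENNReal.mul_rpow_of_nonneg _ _ hp.le, ← ENNReal.rpow_mul,
    one_div_mul_cancel hp.ne', ENNReal.rpow_one]
  calc ‖u x‖ₑ ^ p = (ENNReal.ofReal (⨅ x, G.μ x))⁻¹ *
        (ENNReal.ofReal (⨅ x, G.μ x) * ‖u x‖ₑ ^ p) := by
        rw [← mul_assoc, ENNReal.inv_mul_cancel hm0 ENNReal.ofReal_ne_top, one_mul]
    _ ≤ _ := by gcongr

lemma aestronglyMeasurable_of_discrete (u : V → ℝ) :
    MeasureTheory.AEStronglyMeasurable u G.measure :=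
  Measurable.of_discrete.aestronglyMeasurable

/-- Since `inf μ > 0`, boundedness follows from finiteness of the Sobolev norm. -/
lemma mem_sobolevSubmodule_iff [hp : Fact (2 ≤ p)] (hμ : 0 < ⨅ x, G.μ x) {u : V → ℝ} :
    u ∈ G.sobolevSubmodule s p ↔ G.sobolevENorm s p u < ∞ := by
  have hp0 : 0 < p := by linarith [hp.out]
  have hiff : G.sobolevENorm s p u < ∞ ↔
      ∫⁻ x, (G.fracGradientLength s u x ^ p + ‖u x‖ₑ ^ p) ∂G.measure < ∞ :=
    ENNReal.rpow_lt_top_iff_of_pos (by positivity)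
  refine ⟨fun h => hiff.2 h.2, fun h => ⟨⟨aestronglyMeasurable_of_discrete u, ?_⟩, hiff.1 h⟩⟩
  rw [MeasureTheory.eLpNorm_exponent_top]
  refine (MeasureTheory.eLpNormEssSup_le_of_ae_enorm_bound
    (Filter.Eventually.of_forall fun x =>
      enorm_apply_le_sobolevENorm (s := s) hμ hp0 u x)).trans_lt ?_
  refine ENNReal.mul_lt_top (ENNReal.rpow_lt_top_of_nonneg (by positivity) ?_) h
  exact ENNReal.inv_ne_top.2 (ENNReal.ofReal_pos.2 hμ).ne'

/-! ### Functions of finite support -/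

/-- For the indicator function of `z`, the energy density `|∇^s u|^p μ` at `x ≠ z` is
`(W_s(x, z) / (2 μ(x)))^{p/2} μ(x)`, which is at most a constant times `W_s(x, z)` because `p ≥ 2`
and the quotients are bounded. -/
lemma single_mem_sobolevSubmodule [DecidableEq V] [hp : Fact (2 ≤ p)] (hlf : G.IsLocallyFinite)
    (hsc : G.IsStochasticallyComplete) (hμ : 0 < ⨅ x, G.μ x) (hs : s ∈ Set.Ioo (0 : ℝ) 1) (z : V) :
    (Pi.single z 1 : V → ℝ) ∈ G.sobolevSubmodule s p := by
  have hp2 := hp.out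
  have hp0 : 0 < p := by linarith
  set u : V → ℝ := Pi.single z 1 with hu
  set m : ℝ := ⨅ x, G.μ x with hm
  set S : ℝ≥0∞ := ∑' y, ENNReal.ofReal (G.fracKernel s z y) with hS
  have hSfin : S < ∞ := tsum_fracKernel_lt_top hlf hsc hs z
  have hW := fracKernel_nonneg hlf hs
  have hsq : ∀ x, G.fracGradientLength s u x ^ p =
      (G.fracGradientLength s u x ^ (2 : ℝ)) ^ (p / 2) :=
    fun x => by rw [← ENNReal.rpow_mul]; congr 1; ring
  -- the squared length at `x ≠ z` comes from the edge to `z` alone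
  have hne : ∀ x, x ≠ z → G.fracGradientLength s u x ^ (2 : ℝ)
      = ENNReal.ofReal (G.fracKernel s z x / (2 * G.μ x)) := fun x hx => by
    rw [fracGradientLength_rpow_two, tsum_eq_single z]
    · rw [enorm_fracGradient_rpow_two _ (hW x z), fracKernel_comm]
      simp [hu, hx]
    · intro y hy
      rw [enorm_fracGradient_rpow_two _ (hW x y)]
      simp [hu, hx, hy]
  have hself : G.fracGradientLength s u z ^ (2 : ℝ) < ∞ := by
    refine lt_of_le_of_lt ?_ (ENNReal.mul_lt_top hSfin
      (ENNReal.ofReal_lt_top (r := 1 / (2 * G.μ z))))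
    rw [fracGradientLength_rpow_two, hS, ← ENNReal.tsum_mul_right]
    refine ENNReal.tsum_le_tsum fun y => ?_
    have h2 := G.μ_pos z
    rw [enorm_fracGradient_rpow_two _ (hW z y), ← ENNReal.ofReal_mul (hW z y)]
    refine ENNReal.ofReal_le_ofReal ?_
    rw [div_eq_mul_one_div]
    refine mul_le_of_le_one_right (mul_nonneg (hW z y) (by positivity)) ?_
    rcases eq_or_ne y z with rfl | hy
    · simp
    · simp [hu, hy]
  have hselfp : G.fracGradientLength s u z ^ p < ∞ := by
    rw [hsq]
    exact ENNReal.rpow_lt_top_of_nonneg (by positivity) hself.ne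
  set M : ℝ≥0∞ := (S * ENNReal.ofReal (1 / (2 * m))) ^ (p / 2 - 1) with hM
  have hMfin : M < ∞ := ENNReal.rpow_lt_top_of_nonneg (by linarith)
    (ENNReal.mul_lt_top hSfin ENNReal.ofReal_lt_top).ne
  have hterm : ∀ x, ENNReal.ofReal (G.μ x) * G.fracGradientLength s u x ^ p ≤
      (if x = z then ENNReal.ofReal (G.μ x) * G.fracGradientLength s u x ^ p else 0)
        + M * ENNReal.ofReal (G.fracKernel s z x) := fun x => by
    by_cases hx : x = z
    · simp [hx]
    rw [if_neg hx, zero_add]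
    have hμx := G.μ_pos x
    have hle : G.fracGradientLength s u x ^ (2 : ℝ) ≤ S * ENNReal.ofReal (1 / (2 * m)) := by
      rw [hne x hx, div_eq_mul_one_div, ENNReal.ofReal_mul (hW z x)]
      gcongr
      · exact ENNReal.le_tsum x
      · exact G.iInf_μ_le x
    calc ENNReal.ofReal (G.μ x) * G.fracGradientLength s u x ^ p
        = (G.fracGradientLength s u x ^ (2 : ℝ)) ^ (p / 2 - 1) *
            (ENNReal.ofReal (G.μ x) * G.fracGradientLength s u x ^ (2 : ℝ)) := by
          rw [hsq, mul_left_comm]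
          congr 1
          have h1 := ENNReal.rpow_add_of_nonneg (x := G.fracGradientLength s u x ^ (2 : ℝ))
            (p / 2 - 1) 1 (by linarith) zero_le_one
          rwa [sub_add_cancel, ENNReal.rpow_one] at h1
      _ ≤ M * ENNReal.ofReal (G.fracKernel s z x) := by
          gcongr
          · exact ENNReal.rpow_le_rpow hle (by linarith)
          · rw [hne x hx, ← ENNReal.ofReal_mul hμx.le]
            refine ENNReal.ofReal_le_ofReal ?_
            have := hW z x
            rw [show G.μ x * (G.fracKernel s z x / (2 * G.μ x)) = G.fracKernel s z x / 2 by
              field_simp]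
            linarith
  refine ⟨MeasureTheory.memLp_top_of_bound (aestronglyMeasurable_of_discrete u) 1
    (Filter.Eventually.of_forall fun x => ?_), ?_⟩
  · rcases eq_or_ne x z with rfl | hx
    · simp [hu]
    · simp [hu, hx]
  rw [MeasureTheory.lintegral_add_left Measurable.of_discrete, lintegral_measure,
    lintegral_measure]
  refine ENNReal.add_lt_top.2 ⟨(ENNReal.tsum_le_tsum hterm).trans_lt ?_, ?_⟩
  · rw [ENNReal.tsum_add, tsum_ite_eq, ENNReal.tsum_mul_left]
    exact ENNReal.add_lt_top.2 ⟨ENNReal.mul_lt_top ENNReal.ofReal_lt_top hselfp,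
      ENNReal.mul_lt_top hMfin hSfin⟩
  · rw [tsum_eq_single z]
    · simp [hu]
    · intro x hx
      simp [hu, hx, hp0]

lemma mem_sobolevSubmodule_of_finite_support [Fact (2 ≤ p)] (hlf : G.IsLocallyFinite)
    (hsc : G.IsStochasticallyComplete) (hμ : 0 < ⨅ x, G.μ x) (hs : s ∈ Set.Ioo (0 : ℝ) 1)
    {u : V → ℝ} (hu : u.support.Finite) : u ∈ G.sobolevSubmodule s p := by
  classical
  have hsum : u = ∑ z ∈ hu.toFinset, u z • (Pi.single z 1 : V → ℝ) := by
    funext x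
    simp [Finset.sum_apply, Pi.single_apply]
  rw [hsum]
  exact Submodule.sum_mem _ fun z _ =>
    Submodule.smul_mem _ _ (single_mem_sobolevSubmodule hlf hsc hμ hs z)

/-! ### Embedding into `L^q` and normal contractions -/

/-- By interpolation between `L^p` and `L^∞`: `∫ |u|^q ≤ (sup |u|)^{q-p} ∫ |u|^p`. -/
lemma exists_eLpNorm_le_sobolevENorm (s : ℝ) (hμ : 0 < ⨅ x, G.μ x) (hp : 0 < p) {q : ℝ≥0∞}
    (hq : ENNReal.ofReal p ≤ q) :
    ∃ C : ℝ≥0, ∀ u : V → ℝ, MeasureTheory.eLpNorm u q G.measure ≤ C * G.sobolevENorm s p u := by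
  set A : ℝ≥0∞ := (ENNReal.ofReal (⨅ x, G.μ x))⁻¹ ^ (1 / p) with hA
  have hAfin : A ≠ ∞ := ENNReal.rpow_ne_top_of_nonneg (by positivity)
    (ENNReal.inv_ne_top.2 (ENNReal.ofReal_pos.2 hμ).ne')
  have hsup := fun u : V → ℝ => enorm_apply_le_sobolevENorm (s := s) hμ hp u
  rcases eq_or_ne q ∞ with rfl | hqt
  · refine ⟨A.toNNReal, fun u => ?_⟩
    rw [ENNReal.coe_toNNReal hAfin, MeasureTheory.eLpNorm_exponent_top]
    exact MeasureTheory.eLpNormEssSup_le_of_ae_enorm_bound (Filter.Eventually.of_forall (hsup u))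
  set r := q.toReal with hr
  have hpr : p ≤ r := (ENNReal.ofReal_le_iff_le_toReal hqt).1 hq
  have hr0 : 0 < r := hp.trans_le hpr
  have hBfin : (A ^ (r - p)) ^ (1 / r) ≠ ∞ := ENNReal.rpow_ne_top_of_nonneg (by positivity)
    (ENNReal.rpow_ne_top_of_nonneg (by linarith) hAfin)
  refine ⟨((A ^ (r - p)) ^ (1 / r)).toNNReal, fun u => ?_⟩
  rw [ENNReal.coe_toNNReal hBfin, MeasureTheory.eLpNorm_eq_lintegral_rpow_enorm_toReal
    (ENNReal.toReal_pos_iff.1 hr0).1.ne' hqt, ← hr]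
  have hpt : ∀ x, ‖u x‖ₑ ^ r ≤ (A * G.sobolevENorm s p u) ^ (r - p) * ‖u x‖ₑ ^ p := fun x => by
    calc ‖u x‖ₑ ^ r = ‖u x‖ₑ ^ (r - p) * ‖u x‖ₑ ^ p := by
          rw [← ENNReal.rpow_add_of_nonneg _ _ (by linarith) hp.le, sub_add_cancel]
      _ ≤ _ := by
          gcongr
          exact hsup u x
  have hint : ∫⁻ x, ‖u x‖ₑ ^ r ∂G.measure ≤ A ^ (r - p) * G.sobolevENorm s p u ^ r := by
    refine (MeasureTheory.lintegral_mono hpt).trans ?_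
    rw [MeasureTheory.lintegral_const_mul _ Measurable.of_discrete]
    refine (mul_le_mul_right (lintegral_enorm_rpow_le_sobolevENorm_rpow (s := s) hp u) _).trans
      (le_of_eq ?_)
    rw [ENNReal.mul_rpow_of_nonneg _ _ (by linarith), mul_assoc,
      ← ENNReal.rpow_add_of_nonneg _ _ (by linarith) hp.le, sub_add_cancel]
  refine (ENNReal.rpow_le_rpow hint (by positivity)).trans (le_of_eq ?_)
  rw [ENNReal.mul_rpow_of_nonneg _ _ (by positivity), ← ENNReal.rpow_mul _ r,
    mul_one_div_cancel hr0.ne', ENNReal.rpow_one]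

lemma comp_mem_sobolevSubmodule [hp : Fact (2 ≤ p)] {u : V → ℝ} (hu : u ∈ G.sobolevSubmodule s p)
    {φ : ℝ → ℝ} (hφ0 : φ 0 = 0) (hφ : ∀ a b, |φ a - φ b| ≤ |a - b|) :
    (fun x => φ (u x)) ∈ G.sobolevSubmodule s p := by
  have hp2 := hp.out
  have hle : ∀ x, |φ (u x)| ≤ |u x| := fun x => by simpa [hφ0] using hφ (u x) 0
  refine ⟨hu.1.of_le (aestronglyMeasurable_of_discrete _) (Filter.Eventually.of_forall hle), ?_⟩
  refine lt_of_le_of_lt (MeasureTheory.lintegral_mono fun x => ?_) hu.2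
  have h1 : G.fracGradientLength s (fun x => φ (u x)) x ≤ G.fracGradientLength s u x := by
    unfold fracGradientLength
    gcongr with y
    rw [enorm_le_iff_norm_le, fracGradient, fracGradient, norm_mul, norm_mul]
    exact mul_le_mul_of_nonneg_left (hφ _ _) (norm_nonneg _)
  have h2 : ‖φ (u x)‖ₑ ≤ ‖u x‖ₑ := enorm_le_iff_norm_le.2 (hle x)
  exact add_le_add (ENNReal.rpow_le_rpow h1 (by linarith)) (ENNReal.rpow_le_rpow h2 (by linarith))

end Sobolev

/-! ### Completeness and uniform convexity -/

section Banach

open Filter Topology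

variable {V : Type*} {G : WeightedGraph V} {s p : ℝ}

lemma lowerSemicontinuous_fracGradientLength (x : V) :
    LowerSemicontinuous fun u : V → ℝ => G.fracGradientLength s u x := by
  refine (ENNReal.continuous_rpow_const (y := 1 / 2)).comp_lowerSemicontinuous
    (lowerSemicontinuous_tsum fun y => ?_) (ENNReal.monotone_rpow_of_nonneg (by norm_num))
  refine (ENNReal.continuous_rpow_const.comp (continuous_enorm.comp ?_)).lowerSemicontinuous
  unfold fracGradient
  fun_prop

/-- The parallelogram identity for the length of the fractional gradient. -/
lemma fracGradientLength_add_sub (u v : V → ℝ) (x : V) :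
    G.fracGradientLength s (u + v) x ^ (2 : ℝ) + G.fracGradientLength s (u - v) x ^ (2 : ℝ)
      = 2 * (G.fracGradientLength s u x ^ (2 : ℝ) + G.fracGradientLength s v x ^ (2 : ℝ)) := by
  simp only [fracGradientLength_rpow_two]
  rw [← ENNReal.tsum_add, ← ENNReal.tsum_add, ← ENNReal.tsum_mul_left]
  congr 1 with y
  rw [← enorm_add_rpow_two_add_enorm_sub_rpow_two]
  simp only [fracGradient, Pi.add_apply, Pi.sub_apply]
  ring_nf

variable [MeasurableSpace V] [DiscreteMeasurableSpace V]

/-- Fatou's lemma: the Sobolev norm is lower semicontinuous for pointwise convergence. -/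
lemma lowerSemicontinuous_sobolevENorm (hp : 0 < p) :
    LowerSemicontinuous fun u : V → ℝ => G.sobolevENorm s p u := by
  unfold sobolevENorm
  simp only [lintegral_measure]
  refine (ENNReal.continuous_rpow_const (y := 1 / p)).comp_lowerSemicontinuous
    (lowerSemicontinuous_tsum fun x => ?_) (ENNReal.monotone_rpow_of_nonneg (by positivity))
  refine (ENNReal.continuous_const_mul ENNReal.ofReal_ne_top).comp_lowerSemicontinuous
    (LowerSemicontinuous.add ?_ ?_) fun a b h => mul_le_mul_right h _
  · exact (ENNReal.continuous_rpow_const (y := p)).comp_lowerSemicontinuous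
      (lowerSemicontinuous_fracGradientLength x) (ENNReal.monotone_rpow_of_nonneg hp.le)
  · exact (ENNReal.continuous_rpow_const.comp
      (continuous_enorm.comp (continuous_apply x))).lowerSemicontinuous

lemma SobolevSpace.ofReal_norm [Fact (2 ≤ p)] (u : G.SobolevSpace s p) :
    ENNReal.ofReal ‖u‖ = G.sobolevENorm s p u :=
  ENNReal.ofReal_toReal (SobolevSpace.sobolevENorm_ne_top G s p u)

/-- A Cauchy sequence converges pointwise, since the norm dominates the supremum norm, and by lower
semicontinuity it converges to the pointwise limit in norm. -/
lemma SobolevSpace.completeSpace [hp : Fact (2 ≤ p)] (hμ : 0 < ⨅ x, G.μ x) :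
    CompleteSpace (G.SobolevSpace s p) := by
  have hp0 : 0 < p := by linarith [hp.out]
  refine Metric.complete_of_cauchySeq_tendsto fun u hu => ?_
  set A : ℝ≥0∞ := (ENNReal.ofReal (⨅ x, G.μ x))⁻¹ ^ (1 / p) with hA
  have hAfin : A ≠ ∞ := ENNReal.rpow_ne_top_of_nonneg (by positivity)
    (ENNReal.inv_ne_top.2 (ENNReal.ofReal_pos.2 hμ).ne')
  have hpt : ∀ (v : G.SobolevSpace s p) x, |v.1 x| ≤ A.toReal * ‖v‖ := fun v x => by
    have h := enorm_apply_le_sobolevENorm (s := s) hμ hp0 v.1 x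
    have := ENNReal.toReal_mono
      (ENNReal.mul_ne_top hAfin (SobolevSpace.sobolevENorm_ne_top G s p v)) h
    rwa [ENNReal.toReal_mul, toReal_enorm] at this
  have hlim : ∀ x, ∃ a, Tendsto (fun n => (u n).1 x) atTop (𝓝 a) := fun x => by
    refine cauchySeq_tendsto_of_complete (Metric.cauchySeq_iff'.2 fun ε hε => ?_)
    obtain ⟨N, hN⟩ := Metric.cauchySeq_iff'.1 hu (ε / (A.toReal + 1)) (by positivity)
    refine ⟨N, fun n hn => ?_⟩
    have h1 := hN n hn
    rw [dist_eq_norm, lt_div_iff₀ (by positivity)] at h1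
    have h2 : |(u n).1 x - (u N).1 x| ≤ A.toReal * ‖u n - u N‖ := hpt (u n - u N) x
    rw [Real.dist_eq]
    nlinarith [norm_nonneg (u n - u N)]
  choose f hf using hlim
  have hdiff : ∀ ε > 0, ∃ N, ∀ n ≥ N,
      G.sobolevENorm s p ((u n).1 - f) ≤ ENNReal.ofReal ε := fun ε hε => by
    obtain ⟨N, hN⟩ := Metric.cauchySeq_iff.1 hu ε hε
    refine ⟨N, fun n hn => le_of_forall_lt fun b hb => ?_⟩
    have hconv : Tendsto (fun k => (u n).1 - (u k).1) atTop (𝓝 ((u n).1 - f)) :=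
      tendsto_const_nhds.sub (tendsto_pi_nhds.2 hf)
    obtain ⟨k, hk, hkN⟩ := ((hconv.eventually (lowerSemicontinuous_sobolevENorm hp0 _ b hb)).and
      (eventually_ge_atTop N)).exists
    refine hk.trans_le ?_
    have h1 := (hN n hn k hkN).le
    rw [dist_eq_norm] at h1
    exact (SobolevSpace.ofReal_norm (u n - u k)).symm.trans_le (ENNReal.ofReal_le_ofReal h1)
  have hfmem : f ∈ G.sobolevSubmodule s p := by
    obtain ⟨N, hN⟩ := hdiff 1 one_pos
    have h1 := (mem_sobolevSubmodule_iff hμ).2 ((hN N le_rfl).trans_lt ENNReal.ofReal_lt_top)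
    have h2 := Submodule.sub_mem _ (u N).2 h1
    rwa [sub_sub_cancel] at h2
  let F : G.SobolevSpace s p := ⟨f, hfmem⟩
  refine ⟨F, Metric.tendsto_atTop.2 fun ε hε => ?_⟩
  obtain ⟨N, hN⟩ := hdiff (ε / 2) (by positivity)
  refine ⟨N, fun n hn => ?_⟩
  have h1 : ENNReal.ofReal ‖u n - F‖ ≤ ENNReal.ofReal (ε / 2) :=
    (SobolevSpace.ofReal_norm (u n - F)).trans_le (hN n hn)
  rw [ENNReal.ofReal_le_ofReal_iff (by positivity)] at h1
  rw [dist_eq_norm]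
  linarith

lemma SobolevSpace.norm_add_rpow_add_norm_sub_rpow_le [hp : Fact (2 ≤ p)]
    (u v : G.SobolevSpace s p) :
    ‖u + v‖ ^ p + ‖u - v‖ ^ p ≤ 2 ^ (p - 1) * (‖u‖ ^ p + ‖v‖ ^ p) := by
  have hp2 := hp.out
  have hp0 : 0 < p := by linarith
  have key : G.sobolevENorm s p (u.1 + v.1) ^ p + G.sobolevENorm s p (u.1 - v.1) ^ p
      ≤ 2 ^ (p - 1) * (G.sobolevENorm s p u.1 ^ p + G.sobolevENorm s p v.1 ^ p) := by
    simp only [sobolevENorm_rpow hp0]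
    rw [← MeasureTheory.lintegral_add_left Measurable.of_discrete,
      ← MeasureTheory.lintegral_add_left Measurable.of_discrete,
      ← MeasureTheory.lintegral_const_mul _ Measurable.of_discrete]
    refine MeasureTheory.lintegral_mono fun x => ?_
    have h1 := ENNReal.rpow_add_rpow_le_of_parallelogram hp2
      (fracGradientLength_add_sub (G := G) (s := s) u.1 v.1 x)
    have h2 := ENNReal.rpow_add_rpow_le_of_parallelogram hp2
      (enorm_add_rpow_two_add_enorm_sub_rpow_two (u.1 x) (v.1 x))
    calc _ = (G.fracGradientLength s (u.1 + v.1) x ^ p + G.fracGradientLength s (u.1 - v.1) x ^ p)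
          + (‖u.1 x + v.1 x‖ₑ ^ p + ‖u.1 x - v.1 x‖ₑ ^ p) := add_add_add_comm _ _ _ _
      _ ≤ _ := add_le_add h1 h2
      _ = _ := by rw [← mul_add, add_add_add_comm]
  have e1 := SobolevSpace.ofReal_norm (u + v)
  have e2 := SobolevSpace.ofReal_norm (u - v)
  change _ = G.sobolevENorm s p (u.1 + v.1) at e1
  change _ = G.sobolevENorm s p (u.1 - v.1) at e2
  have h2 : (2 : ℝ≥0∞) = ENNReal.ofReal 2 := by simp
  rw [← e1, ← e2, ← SobolevSpace.ofReal_norm, ← SobolevSpace.ofReal_norm, h2,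
    ENNReal.ofReal_rpow_of_pos two_pos] at key
  simp only [ENNReal.ofReal_rpow_of_nonneg (norm_nonneg _) hp0.le] at key
  rwa [← ENNReal.ofReal_add (by positivity) (by positivity),
    ← ENNReal.ofReal_add (by positivity) (by positivity), ← ENNReal.ofReal_mul (by positivity),
    ENNReal.ofReal_le_ofReal_iff (by positivity)] at key

lemma SobolevSpace.uniformConvexSpace [hp : Fact (2 ≤ p)] :
    UniformConvexSpace (G.SobolevSpace s p) :=
  uniformConvexSpace_of_clarkson (by linarith [hp.out])
    SobolevSpace.norm_add_rpow_add_norm_sub_rpow_le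

end Banach

end WeightedGraph

theorem mainTheorem1 {V : Type*} [MeasurableSpace V] [DiscreteMeasurableSpace V]
    (G : WeightedGraph V) (hconn : G.graph.Connected) (hlf : G.IsLocallyFinite)
    (hsc : G.IsStochasticallyComplete) (hμ : 0 < ⨅ x, G.μ x)
    (s : ℝ) (hs : s ∈ Set.Ioo (0 : ℝ) 1) (p : ℝ) [Fact (2 ≤ p)] :
    -- functions with finite support belong to the space
    (∀ u : V → ℝ, u.support.Finite → u ∈ G.sobolevSubmodule s p) ∧
    -- it is a reflexive Banach space
    (CompleteSpace (G.SobolevSpace s p) ∧ IsReflexiveSpace (G.SobolevSpace s p)) ∧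
    -- it is continuously embedded in `L^q(V)` for every `q ∈ [p, ∞]`
    (∀ q : ℝ≥0∞, ENNReal.ofReal p ≤ q →
      ∃ C : ℝ≥0, ∀ u : G.SobolevSpace s p, MeasureTheory.MemLp u q G.measure ∧
        MeasureTheory.eLpNorm u q G.measure ≤ C * ENNReal.ofReal ‖u‖) ∧
    -- it is closed under positive part, negative part and absolute value
    (∀ u ∈ G.sobolevSubmodule s p,
      (fun x => max (u x) 0) ∈ G.sobolevSubmodule s p ∧
      (fun x => min (u x) 0) ∈ G.sobolevSubmodule s p ∧
      (fun x => |u x|) ∈ G.sobolevSubmodule s p) := by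
  have hcomplete : CompleteSpace (G.SobolevSpace s p) :=
    WeightedGraph.SobolevSpace.completeSpace hμ
  have hconvex : UniformConvexSpace (G.SobolevSpace s p) :=
    WeightedGraph.SobolevSpace.uniformConvexSpace
  refine ⟨fun u hu => WeightedGraph.mem_sobolevSubmodule_of_finite_support hlf hsc hμ hs hu,
    ⟨hcomplete, isReflexiveSpace_of_uniformConvexSpace⟩, fun q hq => ?_, fun u hu => ⟨?_, ?_, ?_⟩⟩
  · have hp0 : 0 < p := by linarith [(Fact.out : 2 ≤ p)]
    obtain ⟨C, hC⟩ := WeightedGraph.exists_eLpNorm_le_sobolevENorm (G := G) s hμ hp0 hq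
    refine ⟨C, fun u => ⟨⟨WeightedGraph.aestronglyMeasurable_of_discrete _,
      (hC u.1).trans_lt (ENNReal.mul_lt_top ENNReal.coe_lt_top
        (WeightedGraph.SobolevSpace.sobolevENorm_ne_top G s p u).lt_top)⟩, ?_⟩⟩
    rw [WeightedGraph.SobolevSpace.ofReal_norm]
    exact hC u.1
  · exact WeightedGraph.comp_mem_sobolevSubmodule hu (φ := fun a => max a 0) (max_self 0)
      fun a b => by simpa using abs_max_sub_max_le_abs a b 0
  · exact WeightedGraph.comp_mem_sobolevSubmodule hu (φ := fun a => min a 0) (min_self 0)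
      fun a b => by simpa using abs_min_sub_min_le_max a 0 b 0
  · exact WeightedGraph.comp_mem_sobolevSubmodule hu (φ := fun a => |a|) abs_zero
      fun a b => abs_abs_sub_abs_le a b
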